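/- For an integer $n\ge 10$, let $H_n$ be the tree on $n$ vertices obtained from the path with $n-4$ vertices, labelled consecutively $0,1,\dots,n-5$, by attaching a pendant path with two edges at the vertex $2$ and another pendant path with two edges at the vertex $n-7$. Let $\lambda_1(H_n)\ge\lambda_2(H_n)\ge\cdots\ge\lambda_n(H_n)$ be the eigenvalues, with multiplicity, of the adjacency matrix of $H_n$. Then $$\lambda_2(H_n)\;\begin{cases}<2 & \text{for } 10\le n<15,\\ =2 & \text{for } n=15,\\ \in\left(2,\sqrt{2+\sqrt5}\right) & \text{for } n>15.\end{cases}$$ -/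

import Mathlib

/-- The edges (each in one orientation) of the open quipu with main path `0, 1, …, r - 1`, where a
pendant path with `l i` edges is attached at the vertex `m i` of the main path. The vertex
`Sum.inl a` is the vertex `a` of the main path; `Sum.inr ⟨i, j⟩` is the vertex of the `i`-th
pendant path that has distance `j + 1` from the main path. -/
def OpenQuipuEdge {t : ℕ} (l m : Fin t → ℕ) (r : ℕ) :
    Fin r ⊕ (Σ i : Fin t, Fin (l i)) → Fin r ⊕ (Σ i : Fin t, Fin (l i)) → Prop
  | Sum.inl a, Sum.inl b => a.val + 1 = b.val
  | Sum.inl a, Sum.inr p => a.val = m p.1 ∧ p.2.val = 0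
  | Sum.inr p, Sum.inr q => p.1 = q.1 ∧ p.2.val + 1 = q.2.val
  | Sum.inr _, Sum.inl _ => False

instance {t : ℕ} (l m : Fin t → ℕ) (r : ℕ) : DecidableRel (OpenQuipuEdge l m r)
  | Sum.inl a, Sum.inl b => inferInstanceAs (Decidable (a.val + 1 = b.val))
  | Sum.inl a, Sum.inr p => inferInstanceAs (Decidable (a.val = m p.1 ∧ p.2.val = 0))
  | Sum.inr p, Sum.inr q => inferInstanceAs (Decidable (p.1 = q.1 ∧ p.2.val + 1 = q.2.val))
  | Sum.inr _, Sum.inl _ => inferInstanceAs (Decidable False)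

/-- The open quipu `P_{l 0, …, l (t-1); r}^{m 0, …, m (t-1)}`: the graph obtained from the path on
the vertices `0, …, r - 1` by attaching at its vertex `m i` a pendant path of `l i` edges, for each
`i`. (Meant for `0 < m 0 < ⋯ < m (t-1) < r - 1`.) -/
def openQuipu {t : ℕ} (l m : Fin t → ℕ) (r : ℕ) :
    SimpleGraph (Fin r ⊕ (Σ i : Fin t, Fin (l i))) :=
  SimpleGraph.fromRel (OpenQuipuEdge l m r)

instance {t : ℕ} (l m : Fin t → ℕ) (r : ℕ) : DecidableRel (openQuipu l m r).Adj :=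
  inferInstanceAs (DecidableRel (SimpleGraph.fromRel (OpenQuipuEdge l m r)).Adj)

/-- The vertices of `H_n`: a path on `n - 4` vertices and two pendant paths of two edges each. -/
abbrev HVertex (n : ℕ) : Type := Fin (n - 4) ⊕ (Σ _ : Fin 2, Fin 2)

/-- The H-shape tree `H_n = P_{2,2;n-4}^{2,n-7}` (for `n ≥ 10`). -/
abbrev hGraph (n : ℕ) : SimpleGraph (HVertex n) :=
  openQuipu (fun _ : Fin 2 => 2) ![2, n - 7] (n - 4)

/-- `H_n` has `n` vertices. -/
theorem card_HVertex {n : ℕ} (hn : 10 ≤ n) : Fintype.card (HVertex n) = n := by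
  simp [HVertex]
  omega

theorem one_lt_card_HVertex {n : ℕ} (hn : 10 ≤ n) : 1 < Fintype.card (HVertex n) := by
  rw [card_HVertex hn]
  omega

/-- The adjacency eigenvalues of a finite graph, with multiplicity, in non-increasing order and
counted from `0`: `λ_{k+1}(G)` is `adjEigenvalue G k`. -/
noncomputable def adjEigenvalue {V : Type*} [Fintype V] [DecidableEq V] (G : SimpleGraph V)
    [DecidableRel G.Adj] (k : Fin (Fintype.card V)) : ℝ :=
  Matrix.IsHermitian.eigenvalues₀ (A := G.adjMatrix ℝ)
    (by
      rw [Matrix.IsHermitian, Matrix.conjTranspose_eq_transpose_of_trivial]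
      exact G.isSymm_adjMatrix) k

/-- The second largest eigenvalue `λ_2(G)` of a graph with at least two vertices (equal to `λ_1(G)`
if the largest eigenvalue is multiple). -/
noncomputable def secondEigenvalue {V : Type*} [Fintype V] [DecidableEq V] (G : SimpleGraph V)
    [DecidableRel G.Adj] (hV : 1 < Fintype.card V) : ℝ :=
  adjEigenvalue G ⟨1, hV⟩

open Matrix in
theorem dotProduct_mulVec_add_eigenvector {V : Type*} [Fintype V] {A : Matrix V V ℝ}
    {u v : V → ℝ} {α β : ℝ} (hu : A *ᵥ u = α • u) (hv : A *ᵥ v = β • v)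
    (huu : u ⬝ᵥ u = 1) (hvv : v ⬝ᵥ v = 1) (huv : u ⬝ᵥ v = 0) (a b : ℝ) :
    (a • u + b • v) ⬝ᵥ A *ᵥ (a • u + b • v) = α * a ^ 2 + β * b ^ 2 ∧
      (a • u + b • v) ⬝ᵥ (a • u + b • v) = a ^ 2 + b ^ 2 := by
  have hvu : v ⬝ᵥ u = 0 := by rw [dotProduct_comm, huv]
  constructor
  · simp only [mulVec_add, mulVec_smul, hu, hv, dotProduct_add, add_dotProduct, smul_dotProduct,
      dotProduct_smul, huu, hvv, huv, hvu, smul_eq_mul]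
    ring
  · simp only [dotProduct_add, add_dotProduct, smul_dotProduct,
      dotProduct_smul, huu, hvv, huv, hvu, smul_eq_mul]
    ring

/-- A nontrivial combination killing two given numbers. -/
theorem exists_combination_eq_zero (p q : ℝ) :
    ∃ a b : ℝ, 0 < a ^ 2 + b ^ 2 ∧ a * p + b * q = 0 := by
  by_cases h : p = 0
  · exact ⟨1, 0, by norm_num, by simp [h]⟩
  · exact ⟨-q, p, by positivity, by ring⟩

open Matrix in
/-- The spectral theorem for the adjacency matrix: an orthonormal eigenbasis, indexed so that its
eigenvalues are in non-increasing order. -/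
theorem exists_adjMatrix_eigenbasis {V : Type*} [Fintype V] [DecidableEq V] (G : SimpleGraph V)
    [DecidableRel G.Adj] :
    ∃ v : OrthonormalBasis (Fin (Fintype.card V)) ℝ (EuclideanSpace ℝ V),
      (∀ k, G.adjMatrix ℝ *ᵥ (v k).ofLp = adjEigenvalue G k • (v k).ofLp) ∧
      Antitone (adjEigenvalue G) := by
  have hA : (G.adjMatrix ℝ).IsHermitian := by
    rw [Matrix.IsHermitian, Matrix.conjTranspose_eq_transpose_of_trivial]
    exact G.isSymm_adjMatrix
  let e : Fin (Fintype.card V) ≃ V := Fintype.equivOfCardEq (Fintype.card_fin _)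
  refine ⟨hA.eigenvectorBasis.reindex e.symm, fun k => ?_, hA.eigenvalues₀_antitone⟩
  have h := hA.mulVec_eigenvectorBasis (e k)
  have he : hA.eigenvalues (e k) = adjEigenvalue G k := by
    simp [Matrix.IsHermitian.eigenvalues, adjEigenvalue, e]
  rw [he] at h
  simpa using h

open Matrix in
theorem EuclideanSpace.inner_eq_ofLp_dotProduct {V : Type*} [Fintype V]
    (x y : EuclideanSpace ℝ V) : inner ℝ x y = x.ofLp ⬝ᵥ y.ofLp := by
  simp [EuclideanSpace.inner_eq_star_dotProduct, dotProduct_comm]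

open Matrix in
/-- Every hyperplane contains a vector whose Rayleigh quotient is at least `λ₂`. -/
theorem exists_secondEigenvalue_le_rayleigh {V : Type*} [Fintype V] [DecidableEq V]
    (G : SimpleGraph V) [DecidableRel G.Adj] (hV : 1 < Fintype.card V) (φ : (V → ℝ) →ₗ[ℝ] ℝ) :
    ∃ x : V → ℝ, φ x = 0 ∧ 0 < x ⬝ᵥ x ∧
      secondEigenvalue G hV * (x ⬝ᵥ x) ≤ x ⬝ᵥ G.adjMatrix ℝ *ᵥ x := by
  obtain ⟨v, hv, hanti⟩ := exists_adjMatrix_eigenbasis G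
  let i0 : Fin (Fintype.card V) := ⟨0, by omega⟩
  let i1 : Fin (Fintype.card V) := ⟨1, hV⟩
  have hn : ∀ i j, (v i).ofLp ⬝ᵥ (v j).ofLp = if i = j then 1 else 0 := fun i j => by
    rw [← EuclideanSpace.inner_eq_ofLp_dotProduct, orthonormal_iff_ite.1 v.orthonormal]
  have h01 : i0 ≠ i1 := by simp [i0, i1]
  obtain ⟨a, b, hab, h0⟩ := exists_combination_eq_zero (φ (v i0).ofLp) (φ (v i1).ofLp)
  obtain ⟨h1, h2⟩ := dotProduct_mulVec_add_eigenvector (hv i0) (hv i1) (by simp [hn])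
    (by simp [hn]) (by simp [hn, h01]) a b
  refine ⟨a • (v i0).ofLp + b • (v i1).ofLp, by simpa using h0, by rwa [h2], ?_⟩
  rw [h1, h2]
  have : adjEigenvalue G i1 ≤ adjEigenvalue G i0 := hanti (by simp [i0, i1, Fin.le_def])
  change adjEigenvalue G i1 * _ ≤ _
  nlinarith [mul_le_mul_of_nonneg_right this (sq_nonneg a)]

open Matrix in
/-- Every plane contains a vector whose Rayleigh quotient is at most `λ₂`. -/
theorem exists_rayleigh_le_secondEigenvalue {V : Type*} [Fintype V] [DecidableEq V]
    (G : SimpleGraph V) [DecidableRel G.Adj] (hV : 1 < Fintype.card V) (y z : V → ℝ) :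
    ∃ a b : ℝ, 0 < a ^ 2 + b ^ 2 ∧
      (a • y + b • z) ⬝ᵥ G.adjMatrix ℝ *ᵥ (a • y + b • z) ≤
        secondEigenvalue G hV * ((a • y + b • z) ⬝ᵥ (a • y + b • z)) := by
  obtain ⟨v, hv, hanti⟩ := exists_adjMatrix_eigenbasis G
  let i0 : Fin (Fintype.card V) := ⟨0, by omega⟩
  let i1 : Fin (Fintype.card V) := ⟨1, hV⟩
  obtain ⟨a, b, hab, h0⟩ := exists_combination_eq_zero ((v i0).ofLp ⬝ᵥ y) ((v i0).ofLp ⬝ᵥ z)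
  refine ⟨a, b, hab, ?_⟩
  set x := a • y + b • z with hx
  have hx0 : (v i0).ofLp ⬝ᵥ x = 0 := by simpa [hx, dotProduct_add] using h0
  have hsym : ∀ k, (v k).ofLp ⬝ᵥ G.adjMatrix ℝ *ᵥ x =
      adjEigenvalue G k * ((v k).ofLp ⬝ᵥ x) := fun k => by
    rw [dotProduct_mulVec, ← mulVec_transpose, G.isSymm_adjMatrix, hv, smul_dotProduct, smul_eq_mul]
  have hparseval : ∀ w : V → ℝ,
      x ⬝ᵥ w = ∑ k, ((v k).ofLp ⬝ᵥ x) * ((v k).ofLp ⬝ᵥ w) := fun w => by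
    have := v.sum_inner_mul_inner (WithLp.toLp 2 x) (WithLp.toLp 2 w)
    simp only [EuclideanSpace.inner_eq_ofLp_dotProduct] at this
    rw [← this]
    exact Finset.sum_congr rfl fun k _ => by rw [dotProduct_comm x]
  rw [hparseval, hparseval x, Finset.mul_sum]
  refine Finset.sum_le_sum fun k _ => ?_
  rw [hsym]
  by_cases hk : k = i0
  · simp [hk, hx0]
  · have hk1 : adjEigenvalue G k ≤ secondEigenvalue G hV := by
      refine hanti ?_
      rw [Fin.le_def]
      have : k.val ≠ 0 := fun h => hk (Fin.ext h)
      simp only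
      omega
    nlinarith [mul_le_mul_of_nonneg_right hk1 (mul_self_nonneg ((v k).ofLp ⬝ᵥ x))]

theorem adjMatrix_openQuipu {t : ℕ} (l m : Fin t → ℕ) (r : ℕ)
    (u v : Fin r ⊕ (Σ i : Fin t, Fin (l i))) :
    (openQuipu l m r).adjMatrix ℝ u v =
      (if OpenQuipuEdge l m r u v then 1 else 0) + (if OpenQuipuEdge l m r v u then 1 else 0) := by
  have hne : OpenQuipuEdge l m r u v → u ≠ v := by
    rintro h rfl
    rcases u with a | p <;> simp [OpenQuipuEdge] at h
  have hasymm : OpenQuipuEdge l m r u v → ¬ OpenQuipuEdge l m r v u := by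
    rcases u with a | p <;> rcases v with b | q <;> simp only [OpenQuipuEdge]
    · omega
    · simp
    · simp
    · rintro ⟨h, h'⟩ ⟨_, h''⟩
      omega
  have hne' : OpenQuipuEdge l m r v u → u ≠ v := by
    rintro h rfl
    rcases u with a | p <;> simp [OpenQuipuEdge] at h
  have hadj : (openQuipu l m r).Adj u v ↔
      u ≠ v ∧ (OpenQuipuEdge l m r u v ∨ OpenQuipuEdge l m r v u) := SimpleGraph.fromRel_adj _ _ _
  rw [SimpleGraph.adjMatrix_apply]
  simp only [hadj]
  by_cases h1 : OpenQuipuEdge l m r u v <;> by_cases h2 : OpenQuipuEdge l m r v u <;>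
    simp_all

theorem openQuipuEdge_inl_inl {t : ℕ} {l m : Fin t → ℕ} {r : ℕ} (a b : Fin r) :
    OpenQuipuEdge l m r (Sum.inl a) (Sum.inl b) ↔ a.val + 1 = b.val := by
  rw [OpenQuipuEdge]

theorem openQuipuEdge_inl_inr {t : ℕ} {l m : Fin t → ℕ} {r : ℕ} (a : Fin r)
    (q : Σ i : Fin t, Fin (l i)) :
    OpenQuipuEdge l m r (Sum.inl a) (Sum.inr q) ↔ a.val = m q.1 ∧ q.2.val = 0 := by
  rw [OpenQuipuEdge]

theorem openQuipuEdge_inr_inl {t : ℕ} {l m : Fin t → ℕ} {r : ℕ} (p : Σ i : Fin t, Fin (l i))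
    (b : Fin r) : OpenQuipuEdge l m r (Sum.inr p) (Sum.inl b) ↔ False := by
  rw [OpenQuipuEdge]

theorem openQuipuEdge_inr_inr {t : ℕ} {l m : Fin t → ℕ} {r : ℕ} (p q : Σ i : Fin t, Fin (l i)) :
    OpenQuipuEdge l m r (Sum.inr p) (Sum.inr q) ↔ p.1 = q.1 ∧ p.2.val + 1 = q.2.val := by
  rw [OpenQuipuEdge]

theorem sum_fin_eq_sum_range_succ_ite (N : ℕ) (F : ℕ → ℝ) (hF : F N = 0) (a : Fin N)
    (inst : ∀ b : Fin N, Decidable (a.val + 1 = b.val)) :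
    ∑ b : Fin N, (if a.val + 1 = b.val then F b else 0) = F (a + 1) := by
  trans ∑ b ∈ Finset.range N, (if a.val + 1 = b then F b else 0)
  · rw [← Fin.sum_univ_eq_sum_range (fun b => if a.val + 1 = b then F b else 0) N]
    exact Finset.sum_congr rfl fun b _ => by congr
  rw [Finset.sum_ite_eq]
  split_ifs with h
  · rfl
  · have : a.val + 1 = N := by
      have := a.2
      simp at h
      omega
    rw [this, hF]

/-- The vector on `H_n` with the entries `F` on the main path and `P` on the pendant paths. -/
def hVec (n : ℕ) (F : ℕ → ℝ) (P : Fin 2 → Fin 2 → ℝ) : HVertex n → ℝ :=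
  Sum.elim (fun i => F i) (fun s => P s.1 s.2)

theorem exists_eq_hVec (n : ℕ) (x : HVertex n → ℝ) :
    ∃ F P, F (n - 4) = 0 ∧ x = hVec n F P := by
  refine ⟨fun i => if h : i < n - 4 then x (Sum.inl ⟨i, h⟩) else 0,
    fun i j => x (Sum.inr ⟨i, j⟩), by simp, ?_⟩
  ext (i | s) <;> simp [hVec]

open Matrix in
theorem hVec_dotProduct_self (n : ℕ) (F : ℕ → ℝ) (P : Fin 2 → Fin 2 → ℝ) :
    hVec n F P ⬝ᵥ hVec n F P = ∑ i ∈ Finset.range (n - 4), F i ^ 2 +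
      (P 0 0 ^ 2 + P 0 1 ^ 2 + P 1 0 ^ 2 + P 1 1 ^ 2) := by
  simp only [dotProduct, hVec, Fintype.sum_sum_type, Sum.elim_inl, Sum.elim_inr, Fintype.sum_sigma,
    Fin.sum_univ_two, ← pow_two, Fin.sum_univ_eq_sum_range (fun i => F i ^ 2)]
  ring

theorem sum_sum_symmetrize_mul {V : Type*} [Fintype V] (E : V → V → Prop) [DecidableRel E]
    (x : V → ℝ) :
    ∑ u, ∑ v, x u * (((if E u v then 1 else 0) + (if E v u then 1 else 0)) * x v) =
      2 * ∑ u, x u * ∑ v, (if E u v then x v else 0) := by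
  simp only [add_mul, mul_add, Finset.sum_add_distrib, two_mul]
  congr 1
  · simp [Finset.mul_sum]
  · rw [Finset.sum_comm]
    simp only [Finset.mul_sum]
    refine Finset.sum_congr rfl fun u _ => Finset.sum_congr rfl fun v _ => ?_
    split_ifs <;> ring

open Matrix in
theorem hVec_quadraticForm {n : ℕ} (hn : 10 ≤ n) (F : ℕ → ℝ) (P : Fin 2 → Fin 2 → ℝ)
    (hF : F (n - 4) = 0) :
    hVec n F P ⬝ᵥ (hGraph n).adjMatrix ℝ *ᵥ hVec n F P =
      2 * (∑ i ∈ Finset.range (n - 4), F i * F (i + 1) +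
        (F 2 * P 0 0 + P 0 0 * P 0 1 + F (n - 7) * P 1 0 + P 1 0 * P 1 1)) := by
  have h1 : hVec n F P ⬝ᵥ (hGraph n).adjMatrix ℝ *ᵥ hVec n F P =
      2 * ∑ u, hVec n F P u * ∑ v,
        (if OpenQuipuEdge (fun _ : Fin 2 => 2) ![2, n - 7] (n - 4) u v then hVec n F P v
          else 0) := by
    rw [← sum_sum_symmetrize_mul]
    simp only [dotProduct, mulVec, Finset.mul_sum, hGraph, adjMatrix_openQuipu]
  rw [h1]
  congr 1
  have hsum : ∀ (j : ℕ) (c : ℝ) (inst : ∀ a : Fin (n - 4), Decidable (a.val = j)), j < n - 4 →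
      ∑ a : Fin (n - 4), (if a.val = j then F a * c else 0) = F j * c := by
    intro j c inst hj
    trans ∑ a ∈ Finset.range (n - 4), (if a = j then F a * c else 0)
    · rw [← Fin.sum_univ_eq_sum_range (fun a => if a = j then F a * c else 0)]
      exact Finset.sum_congr rfl fun b _ => by congr
    · simp [hj]
  simp only [hVec, Fintype.sum_sum_type, Sum.elim_inl, Sum.elim_inr, Fintype.sum_sigma,
    Fin.sum_univ_two, openQuipuEdge_inl_inl, openQuipuEdge_inl_inr, openQuipuEdge_inr_inl,
    openQuipuEdge_inr_inr]
  simp [mul_add, sum_fin_eq_sum_range_succ_ite _ F hF, Finset.sum_add_distrib, hsum 2 _ _ (by omega), hsum (n - 7) _ _ (by omega),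
    Fin.sum_univ_eq_sum_range (fun i => F i * F (i + 1))]
  ring

/-- On a hyperplane `φ = 0` some vector has Rayleigh quotient at least `λ₂(H_n)`, written out. -/
theorem exists_hVec_secondEigenvalue_le {n : ℕ} (hn : 10 ≤ n)
    (φ : (HVertex n → ℝ) →ₗ[ℝ] ℝ) :
    ∃ (F : ℕ → ℝ) (P : Fin 2 → Fin 2 → ℝ), F (n - 4) = 0 ∧ φ (hVec n F P) = 0 ∧
      0 < ∑ i ∈ Finset.range (n - 4), F i ^ 2 +
        (P 0 0 ^ 2 + P 0 1 ^ 2 + P 1 0 ^ 2 + P 1 1 ^ 2) ∧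
      secondEigenvalue (hGraph n) (one_lt_card_HVertex hn) *
        (∑ i ∈ Finset.range (n - 4), F i ^ 2 +
          (P 0 0 ^ 2 + P 0 1 ^ 2 + P 1 0 ^ 2 + P 1 1 ^ 2)) ≤
      2 * (∑ i ∈ Finset.range (n - 4), F i * F (i + 1) +
        (F 2 * P 0 0 + P 0 0 * P 0 1 + F (n - 7) * P 1 0 + P 1 0 * P 1 1)) := by
  obtain ⟨x, h0, hpos, hle⟩ :=
    exists_secondEigenvalue_le_rayleigh (hGraph n) (one_lt_card_HVertex hn) φ
  obtain ⟨F, P, hF, rfl⟩ := exists_eq_hVec n x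
  rw [hVec_quadraticForm hn F P hF, hVec_dotProduct_self] at hle
  rw [hVec_dotProduct_self] at hpos
  exact ⟨F, P, hF, h0, hpos, hle⟩

/-- The same on the hyperplane of vectors vanishing at the vertex `j` of the main path. -/
theorem exists_hVec_apply_eq_zero {n : ℕ} (hn : 10 ≤ n) (j : ℕ) (hj : j < n - 4) :
    ∃ (F : ℕ → ℝ) (P : Fin 2 → Fin 2 → ℝ), F (n - 4) = 0 ∧ F j = 0 ∧
      0 < ∑ i ∈ Finset.range (n - 4), F i ^ 2 +
        (P 0 0 ^ 2 + P 0 1 ^ 2 + P 1 0 ^ 2 + P 1 1 ^ 2) ∧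
      secondEigenvalue (hGraph n) (one_lt_card_HVertex hn) *
        (∑ i ∈ Finset.range (n - 4), F i ^ 2 +
          (P 0 0 ^ 2 + P 0 1 ^ 2 + P 1 0 ^ 2 + P 1 1 ^ 2)) ≤
      2 * (∑ i ∈ Finset.range (n - 4), F i * F (i + 1) +
        (F 2 * P 0 0 + P 0 0 * P 0 1 + F (n - 7) * P 1 0 + P 1 0 * P 1 1)) := by
  obtain ⟨F, P, hF, h0, h⟩ :=
    exists_hVec_secondEigenvalue_le hn (LinearMap.proj (Sum.inl ⟨j, hj⟩))
  exact ⟨F, P, hF, by simpa [hVec] using h0, h⟩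

/-- In every plane some vector has Rayleigh quotient at most `λ₂(H_n)`, written out. -/
theorem exists_hVec_le_secondEigenvalue {n : ℕ} (hn : 10 ≤ n) (F F' : ℕ → ℝ)
    (P P' : Fin 2 → Fin 2 → ℝ) (hF : F (n - 4) = 0) (hF' : F' (n - 4) = 0) :
    ∃ a b : ℝ, 0 < a ^ 2 + b ^ 2 ∧ ∀ (f : ℕ → ℝ) (p : Fin 2 → Fin 2 → ℝ),
      (∀ i, f i = a * F i + b * F' i) → (∀ i j, p i j = a * P i j + b * P' i j) →
      2 * (∑ i ∈ Finset.range (n - 4), f i * f (i + 1) +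
        (f 2 * p 0 0 + p 0 0 * p 0 1 + f (n - 7) * p 1 0 + p 1 0 * p 1 1)) ≤
      secondEigenvalue (hGraph n) (one_lt_card_HVertex hn) *
        (∑ i ∈ Finset.range (n - 4), f i ^ 2 +
          (p 0 0 ^ 2 + p 0 1 ^ 2 + p 1 0 ^ 2 + p 1 1 ^ 2)) := by
  obtain ⟨a, b, hab, h⟩ := exists_rayleigh_le_secondEigenvalue (hGraph n) (one_lt_card_HVertex hn)
    (hVec n F P) (hVec n F' P')
  refine ⟨a, b, hab, fun f p hf hp => ?_⟩
  have hx : a • hVec n F P + b • hVec n F' P' = hVec n f p := by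
    ext (i | s) <;> simp [hVec, hf, hp]
  rw [hx, hVec_quadraticForm hn f p (by simp [hf, hF, hF']), hVec_dotProduct_self] at h
  exact h

/-- The contribution of a pendant path with two edges attached at a vertex with entry `b`. -/
theorem leg_form_nonneg {c κ : ℝ} (hc : 1 < c) (hκ : c ≤ κ * (c ^ 2 - 1)) (b p q : ℝ) :
    0 ≤ c * p ^ 2 + c * q ^ 2 - 2 * p * q - 2 * b * p + κ * b ^ 2 := by
  have h1 : 0 < c ^ 2 - 1 := by nlinarith
  have h2 : 0 ≤ c * (c ^ 2 - 1) *
      (c * p ^ 2 + c * q ^ 2 - 2 * p * q - 2 * b * p + κ * b ^ 2) := by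
    have h3 : 0 ≤ c * (κ * (c ^ 2 - 1) - c) * b ^ 2 :=
      mul_nonneg (mul_nonneg (by linarith) (by linarith)) (sq_nonneg b)
    nlinarith [mul_nonneg h1.le (sq_nonneg (c * q - p)), sq_nonneg ((c ^ 2 - 1) * p - c * b)]
  exact nonneg_of_mul_nonneg_right h2 (by positivity)

theorem secondEigenvalue_hGraph_lt_two {n : ℕ} (hn : 10 ≤ n) (h : n < 15) :
    secondEigenvalue (hGraph n) (one_lt_card_HVertex hn) < 2 := by
  have leg : ∀ b p q : ℝ, 2 * p * q + 2 * b * p ≤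
      199 / 100 * (p ^ 2 + q ^ 2) + 673 / 1000 * b ^ 2 := fun b p q => by
    have := leg_form_nonneg (c := 199 / 100) (κ := 673 / 1000) (by norm_num) (by norm_num) b p q
    linarith
  have edge0 : ∀ x y : ℝ, 2 * x * y ≤ 644 / 1000 * x ^ 2 + 1555 / 1000 * y ^ 2 := fun x y => by
    nlinarith [sq_nonneg (x - 155 / 100 * y), sq_nonneg y]
  have edge1 : ∀ x y : ℝ, 2 * x * y ≤ 435 / 1000 * x ^ 2 + 2990 / 1000 * y ^ 2 := fun x y => by
    nlinarith [sq_nonneg (x - 2299 / 1000 * y), sq_nonneg y]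
  suffices H : secondEigenvalue (hGraph n) (one_lt_card_HVertex hn) ≤ 199 / 100 by linarith
  interval_cases n
  · obtain ⟨F, P, hF, h0, hpos, hle⟩ := exists_hVec_apply_eq_zero hn 2 (by norm_num)
    refine le_of_mul_le_mul_right (hle.trans ?_) hpos
    simp only [Nat.reduceSub, Finset.sum_range_succ, Finset.sum_range_zero, Nat.reduceAdd] at *
    simp only [h0, hF]
    linarith [leg (F 3) (P 1 0) (P 1 1), leg (F 3) (F 4) (F 5), leg 0 (P 0 0) (P 0 1),
      leg 0 (F 1) (F 0), sq_nonneg (F 3)]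
  · obtain ⟨F, P, hF, h0, hpos, hle⟩ := exists_hVec_apply_eq_zero hn 3 (by norm_num)
    refine le_of_mul_le_mul_right (hle.trans ?_) hpos
    simp only [Nat.reduceSub, Finset.sum_range_succ, Finset.sum_range_zero, Nat.reduceAdd] at *
    simp only [h0, hF]
    linarith [leg (F 4) (P 1 0) (P 1 1), leg (F 4) (F 5) (F 6), leg (F 2) (P 0 0) (P 0 1),
      leg (F 2) (F 1) (F 0), sq_nonneg (F 2), sq_nonneg (F 4)]
  · obtain ⟨F, P, hF, h0, hpos, hle⟩ := exists_hVec_apply_eq_zero hn 3 (by norm_num)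
    refine le_of_mul_le_mul_right (hle.trans ?_) hpos
    simp only [Nat.reduceSub, Finset.sum_range_succ, Finset.sum_range_zero, Nat.reduceAdd] at *
    simp only [h0, hF]
    linarith [leg (F 5) (P 1 0) (P 1 1), leg (F 5) (F 6) (F 7), leg (F 2) (P 0 0) (P 0 1),
      leg (F 2) (F 1) (F 0), sq_nonneg (F 2), sq_nonneg (F 4), edge0 (F 5) (F 4)]
  · obtain ⟨F, P, hF, h0, hpos, hle⟩ := exists_hVec_apply_eq_zero hn 4 (by norm_num)
    refine le_of_mul_le_mul_right (hle.trans ?_) hpos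
    simp only [Nat.reduceSub, Finset.sum_range_succ, Finset.sum_range_zero, Nat.reduceAdd] at *
    simp only [h0, hF]
    linarith [leg (F 6) (P 1 0) (P 1 1), leg (F 6) (F 7) (F 8), leg (F 2) (P 0 0) (P 0 1),
      leg (F 2) (F 1) (F 0), sq_nonneg (F 3), sq_nonneg (F 5), edge0 (F 2) (F 3),
      edge0 (F 6) (F 5)]
  · obtain ⟨F, P, hF, h0, hpos, hle⟩ := exists_hVec_secondEigenvalue_le hn
      (LinearMap.proj (Sum.inl ⟨4, by norm_num⟩) + LinearMap.proj (Sum.inl ⟨5, by norm_num⟩))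
    refine le_of_mul_le_mul_right (hle.trans ?_) hpos
    simp only [Nat.reduceSub, Finset.sum_range_succ, Finset.sum_range_zero, Nat.reduceAdd] at *
    have h5 : F 5 = - F 4 := by
      simp [hVec] at h0
      linarith
    have e2 := edge1 (F 6) (F 5)
    rw [h5] at e2
    simp only [h5, hF]
    linarith [leg (F 7) (P 1 0) (P 1 1), leg (F 7) (F 8) (F 9), leg (F 2) (P 0 0) (P 0 1),
      leg (F 2) (F 1) (F 0), edge0 (F 2) (F 3), edge0 (F 7) (F 6), edge1 (F 3) (F 4)]

theorem secondEigenvalue_hGraph_fifteen_le (hn : 10 ≤ 15) :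
    secondEigenvalue (hGraph 15) (one_lt_card_HVertex hn) ≤ 2 := by
  have leg := leg_form_nonneg (c := 2) (κ := 2 / 3) (by norm_num) (by norm_num)
  obtain ⟨F, P, hF, h0, hpos, hle⟩ := exists_hVec_apply_eq_zero hn 5 (by norm_num)
  refine le_of_mul_le_mul_right (hle.trans ?_) hpos
  simp only [Nat.reduceSub, Finset.sum_range_succ, Finset.sum_range_zero, Nat.reduceAdd] at *
  simp only [h0, hF]
  linarith [leg (F 8) (P 1 0) (P 1 1), leg (F 8) (F 9) (F 10), leg (F 2) (P 0 0) (P 0 1),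
    leg (F 2) (F 1) (F 0), sq_nonneg (F 2 - 3 / 2 * F 3), sq_nonneg (F 3 - 2 * F 4),
    sq_nonneg (F 8 - 3 / 2 * F 7), sq_nonneg (F 7 - 2 * F 6)]

theorem two_le_secondEigenvalue_hGraph_fifteen (hn : 10 ≤ 15) :
    2 ≤ secondEigenvalue (hGraph 15) (one_lt_card_HVertex hn) := by
  obtain ⟨a, b, hab, h⟩ := exists_hVec_le_secondEigenvalue hn
    (fun i => ([1, 2, 3, 2, 1] : List ℝ).getD i 0)
    (fun i => ([0, 0, 0, 0, 0, 0, 1, 2, 3, 2, 1] : List ℝ).getD i 0)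
    ![![2, 1], 0] ![0, ![2, 1]] (by simp) (by simp)
  replace h := h _ _ (fun _ => rfl) (fun _ _ => rfl)
  simp [Finset.sum_range_succ] at h
  refine le_of_mul_le_mul_right (a := 24 * (a ^ 2 + b ^ 2)) ?_ (by positivity)
  linarith

theorem two_lt_secondEigenvalue_hGraph {n : ℕ} (hn : 10 ≤ n) (h : 15 < n) :
    2 < secondEigenvalue (hGraph n) (one_lt_card_HVertex hn) := by
  obtain ⟨k, rfl⟩ : ∃ k, n = k + 16 := ⟨n - 16, by omega⟩
  obtain ⟨a, b, hab, h⟩ := exists_hVec_le_secondEigenvalue hn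
    (fun i => ([1, 2, 3, 2, 1, 1 / 2] : List ℝ).getD i 0)
    (fun i => if k + 6 ≤ i then ([1 / 2, 1, 2, 3, 2, 1] : List ℝ).getD (i - (k + 6)) 0 else 0)
    ![![2, 1], 0] ![0, ![2, 1]] (by simp) (by simp)
  obtain ⟨f, hf⟩ : ∃ f : ℕ → ℝ, ∀ i, f i = a * ([1, 2, 3, 2, 1, 1 / 2] : List ℝ).getD i 0 + b *
      (if k + 6 ≤ i then ([1 / 2, 1, 2, 3, 2, 1] : List ℝ).getD (i - (k + 6)) 0 else 0) :=
    ⟨_, fun _ => rfl⟩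
  replace h := h f _ hf (fun _ _ => rfl)
  generalize secondEigenvalue (hGraph (k + 16)) _ = s at h ⊢
  have hmid : ∀ i < k, f (6 + i) = 0 := fun i hi => by
    have h1 : ¬ k + 6 ≤ 6 + i := by omega
    simp only [hf, if_neg h1]
    simp [show 6 + i = i + 6 from add_comm _ _]
  have hright : ∀ i, f (6 + k + i) =
      b * ([1 / 2, 1, 2, 3, 2, 1] : List ℝ).getD i 0 := fun i => by
    have h1 : k + 6 ≤ 6 + k + i := by omega
    have h2 : 6 + k + i - (k + 6) = i := by omega
    simp only [hf, if_pos h1, h2]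
    simp [show 6 + k + i = k + i + 6 by omega]
  have hleft : ∀ i < 6, f i = a * ([1, 2, 3, 2, 1, 1 / 2] : List ℝ).getD i 0 := fun i hi => by
    have h1 : ¬ k + 6 ≤ i := by omega
    simp only [hf, if_neg h1]
    simp
  have hcross : - (1 / 8) * (a ^ 2 + b ^ 2) ≤ f 5 * f 6 := by
    rw [hleft 5 (by norm_num)]
    rcases Nat.eq_zero_or_pos k with rfl | hk
    · rw [hright 0]
      simp
      nlinarith [sq_nonneg (a + b)]
    · rw [hmid 0 hk]
      simp
      positivity
  have hz1 : ∑ i ∈ Finset.range k, f (6 + i) ^ 2 = 0 :=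
    Finset.sum_eq_zero fun i hi => by simp [hmid i (Finset.mem_range.1 hi)]
  have hz2 : ∑ i ∈ Finset.range k, f (6 + i) * f (6 + i + 1) = 0 :=
    Finset.sum_eq_zero fun i hi => by simp [hmid i (Finset.mem_range.1 hi)]
  rw [show k + 16 - 4 = 6 + k + 6 by omega, show k + 16 - 7 = 6 + k + 3 by omega,
    Finset.sum_range_add, Finset.sum_range_add, Finset.sum_range_add, Finset.sum_range_add,
    hz1, hz2] at h
  simp only [Finset.sum_range_succ, Finset.sum_range_zero, hright, add_assoc (6 + k),
    hleft 0 (by norm_num), hleft 1 (by norm_num), hleft 2 (by norm_num), hleft 3 (by norm_num),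
    hleft 4 (by norm_num), Nat.reduceAdd] at h
  rw [hleft 5 (by norm_num)] at h hcross
  simp at h hcross
  by_contra! hle
  nlinarith [mul_le_mul_of_nonneg_right hle hab.le]

theorem tail_form_nonneg {t c : ℝ} (ht : 0 < t) (hc : t * c = t ^ 2 + 1) (g : ℕ → ℝ) (m : ℕ) :
    0 ≤ ∑ i ∈ Finset.range m, (c * g i ^ 2 - 2 * (g i * g (i + 1))) + t * g m ^ 2 := by
  induction m with
  | zero => simp; positivity
  | succ m ih =>
    have : 0 ≤ (c - t) * g m ^ 2 - 2 * (g m * g (m + 1)) + t * g (m + 1) ^ 2 := by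
      refine nonneg_of_mul_nonneg_right (a := t) ?_ ht
      nlinarith [sq_nonneg (g m - t * g (m + 1))]
    rw [Finset.sum_range_succ]
    linarith

theorem tail_form_eq_zero {t c : ℝ} (ht : 0 < t) (hc : t * c = t ^ 2 + 1) (g : ℕ → ℝ) (m : ℕ)
    (h : ∑ i ∈ Finset.range m, (c * g i ^ 2 - 2 * (g i * g (i + 1))) + t * g m ^ 2 ≤ 0) :
    ∀ i ≤ m, g i = 0 := by
  induction m with
  | zero =>
    intro i hi
    obtain rfl : i = 0 := by omega
    simp at h
    have : g 0 ^ 2 ≤ 0 := nonpos_of_mul_nonpos_right h ht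
    exact pow_eq_zero_iff two_ne_zero |>.1 (le_antisymm this (sq_nonneg _))
  | succ m ih =>
    have h2 : 0 ≤ (c - t) * g m ^ 2 - 2 * (g m * g (m + 1)) + t * g (m + 1) ^ 2 := by
      refine nonneg_of_mul_nonneg_right (a := t) ?_ ht
      nlinarith [sq_nonneg (g m - t * g (m + 1))]
    have h1 := tail_form_nonneg ht hc g m
    rw [Finset.sum_range_succ] at h
    have ih := ih (by linarith)
    have h0 : t * g (m + 1) ^ 2 ≤ 0 := by
      have := ih m le_rfl
      rw [this] at h h1
      linarith
    intro i hi
    rcases Nat.le_succ_iff.1 hi with hi | rfl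
    · exact ih i hi
    · exact pow_eq_zero_iff two_ne_zero |>.1
        (le_antisymm (nonpos_of_mul_nonpos_right h0 ht) (sq_nonneg _))

theorem secondEigenvalue_hGraph_lt_of_tail {t c : ℝ} (ht : 0 < t) (hc : t * c = t ^ 2 + 1)
    (hc1 : 1 < c) (hκ : 2 * c = (c - t) * (c ^ 2 - 1)) {n : ℕ} (hn : 11 ≤ n) :
    secondEigenvalue (hGraph n) (one_lt_card_HVertex (by omega)) < c := by
  obtain ⟨m, rfl⟩ : ∃ m, n = m + 11 := ⟨n - 11, by omega⟩
  have leg := leg_form_nonneg (κ := (c - t) / 2) hc1 (by linarith)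
  have leg0 : ∀ p q : ℝ, c * p ^ 2 + c * q ^ 2 - 2 * p * q ≤ 0 → p = 0 ∧ q = 0 := by
    intro p q h
    have h1 : (c - 1) * (p ^ 2 + q ^ 2) ≤ 0 := by nlinarith [sq_nonneg (p - q)]
    have h2 : p ^ 2 + q ^ 2 ≤ 0 := nonpos_of_mul_nonpos_right h1 (by linarith)
    constructor <;> nlinarith [sq_nonneg p, sq_nonneg q]
  obtain ⟨F, P, hF, h0, hpos, hle⟩ := exists_hVec_apply_eq_zero (n := m + 11) (by omega) 3 (by omega)
  by_contra! hlt
  replace hle := (mul_le_mul_of_nonneg_right hlt hpos.le).trans hle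
  have hN : m + 11 - 4 = 4 + m + 3 := by omega
  have hb : m + 11 - 7 = 4 + m := by omega
  rw [hN] at hF hpos hle
  rw [hb] at hle
  simp only [Finset.sum_range_succ, Finset.sum_range_add, Finset.sum_range_zero] at hpos hle
  have htail : ∑ i ∈ Finset.range m, (c * F (4 + i) ^ 2 - 2 * (F (4 + i) * F (4 + (i + 1)))) =
      c * ∑ i ∈ Finset.range m, F (4 + i) ^ 2 -
        2 * ∑ i ∈ Finset.range m, F (4 + i) * F (4 + i + 1) := by
    rw [Finset.mul_sum, Finset.mul_sum, ← Finset.sum_sub_distrib]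
    rfl
  have ht0 := tail_form_nonneg ht hc (fun i => F (4 + i)) m
  have ht1 := tail_form_eq_zero ht hc (fun i => F (4 + i)) m
  simp only [htail] at ht0 ht1
  simp only [Nat.reduceAdd, zero_add, h0, ← add_assoc] at hpos hle htail ht0 ht1
  rw [show 4 + m + 2 + 1 = 4 + m + 3 from rfl, hF] at hle
  have l1 := leg (F 2) (P 0 0) (P 0 1)
  have l2 := leg (F 2) (F 1) (F 0)
  have l3 := leg (F (4 + m)) (P 1 0) (P 1 1)
  have l4 := leg (F (4 + m)) (F (4 + m + 1)) (F (4 + m + 2))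
  have hF2 : 0 ≤ t * F 2 ^ 2 := by positivity
  have hz2 : F 2 = 0 := pow_eq_zero_iff two_ne_zero |>.1
    (le_antisymm (nonpos_of_mul_nonpos_right (by linarith) ht) (sq_nonneg _))
  have hz : ∀ i ≤ m, F (4 + i) = 0 := ht1 (by linarith)
  have hzm := hz m le_rfl
  rw [hz2] at hle hpos l1 l2
  rw [hzm] at hle hpos l3 l4 ht0
  obtain ⟨e1, e2⟩ := leg0 (P 0 0) (P 0 1) (by linarith)
  obtain ⟨e3, e4⟩ := leg0 (F 1) (F 0) (by linarith)
  obtain ⟨e5, e6⟩ := leg0 (P 1 0) (P 1 1) (by linarith)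
  obtain ⟨e7, e8⟩ := leg0 (F (4 + m + 1)) (F (4 + m + 2)) (by linarith)
  have hsum : ∑ i ∈ Finset.range m, F (4 + i) ^ 2 = 0 :=
    Finset.sum_eq_zero fun i hi => by simp [hz i (Finset.mem_range.1 hi).le]
  rw [hsum, e1, e2, e3, e4, e5, e6, e7, e8] at hpos
  norm_num at hpos

theorem exists_tail_parameter : ∃ t : ℝ, 0 < t ∧
    t * √(2 + √5) = t ^ 2 + 1 ∧ 1 < √(2 + √5) ∧
    2 * √(2 + √5) = (√(2 + √5) - t) * (√(2 + √5) ^ 2 - 1) := by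
  set c := √(2 + √5) with hcdef
  set s := √(5:ℝ)
  have hs : s ^ 2 = 5 := Real.sq_sqrt (by norm_num)
  have hs0 : 0 ≤ s := Real.sqrt_nonneg _
  have hc : c ^ 2 = 2 + s := Real.sq_sqrt (by positivity)
  have hc0 : 0 < c := Real.sqrt_pos.2 (by positivity)
  refine ⟨c * ((3 - s) / 2), ?_, ?_, ?_, ?_⟩
  · have : s < 3 := by nlinarith
    have : 0 < 3 - s := by linarith
    positivity
  · rw [mul_pow]
    linear_combination ((3 - s) / 2 - ((3 - s) / 2) ^ 2) * hc + (-1/4 * s + 1/2) * hs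
  · nlinarith
  · linear_combination (-c * (1 - (3 - s) / 2)) * hc - c / 2 * hs

theorem mainTheorem9 (n : ℕ) (hn : 10 ≤ n) :
    (n < 15 → secondEigenvalue (hGraph n) (one_lt_card_HVertex hn) < 2) ∧
    (n = 15 → secondEigenvalue (hGraph n) (one_lt_card_HVertex hn) = 2) ∧
    (15 < n → secondEigenvalue (hGraph n) (one_lt_card_HVertex hn) ∈
      Set.Ioo (2 : ℝ) (Real.sqrt (2 + Real.sqrt 5))) := by
  refine ⟨secondEigenvalue_hGraph_lt_two hn, ?_, fun h => ⟨two_lt_secondEigenvalue_hGraph hn h, ?_⟩⟩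
  · rintro rfl
    exact le_antisymm (secondEigenvalue_hGraph_fifteen_le hn)
      (two_le_secondEigenvalue_hGraph_fifteen hn)
  · obtain ⟨t, ht, hc, hc1, hκ⟩ := exists_tail_parameter
    exact secondEigenvalue_hGraph_lt_of_tail ht hc hc1 hκ (by omega)
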